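/- Let $G$ be a finite group, let $\Delta(G)$ be the augmentation ideal of the integral group ring $\mathbb{Z}G$, let $\mathcal{V}(\mathbb{Z}G)$ be the group of units of augmentation one in $\mathbb{Z}G$, and put $\mathcal{V}_n(\mathbb{Z}G)=\mathcal{V}(\mathbb{Z}G)\cap(1+\Delta^n(G))$ for $n\ge 1$. Call $G$ a cut-group if every central unit of $\mathbb{Z}G$ is trivial, i.e. of the form $\pm g$ with $g\in G$. Then $\mathcal{V}_n(\mathbb{Z}G)=\{1\}$ for some $n\geq 1$ if and only if either (i) $G$ is an abelian cut-group; or (ii) $G\cong K_8\times E$, where $K_8$ is the quaternion group of order $8$ and $E$ is a (possibly trivial) elementary abelian $2$-group. Moreover, if $G$ is abelian, then $G$ is a cut-group if and only if the exponent of $G$ divides $4$ or $6$. -/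

import Mathlib

universe u

/-- The integral group ring `ℤG`. -/
abbrev IntGroupRing (G : Type*) [Group G] : Type _ := MonoidAlgebra ℤ G

/-- The augmentation map `ℤG → ℤ`, which sends every `g : G` to `1`. -/
noncomputable def augmentation (G : Type*) [Group G] : IntGroupRing G →ₐ[ℤ] ℤ :=
  MonoidAlgebra.lift ℤ ℤ G (1 : G →* ℤ)

/-- The augmentation ideal `Δ(G)` of `ℤG`. -/
noncomputable def augIdeal (G : Type*) [Group G] : Ideal (IntGroupRing G) :=
  RingHom.ker (augmentation G)

/-- The group `V(ℤG)` of normalized units: the units of `ℤG` of augmentation one. -/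
noncomputable def normalizedUnits (G : Type*) [Group G] : Subgroup (IntGroupRing G)ˣ :=
  (Units.map (augmentation G : IntGroupRing G →* ℤ)).ker

/-- The units of `ℤG` in `1 + Δⁿ(G)`. -/
noncomputable def deltaUnits (G : Type*) [Group G] (n : ℕ) : Subgroup (IntGroupRing G)ˣ where
  carrier := {u | (u : IntGroupRing G) - 1 ∈ augIdeal G ^ n}
  one_mem' := by simp
  mul_mem' := by
    intro u v hu hv
    have h : ((u * v : (IntGroupRing G)ˣ) : IntGroupRing G) - 1
        = (u : IntGroupRing G) * ((v : IntGroupRing G) - 1) + ((u : IntGroupRing G) - 1) := by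
      simp [mul_sub]
    simp only [Set.mem_ofPred_eq] at hu hv ⊢
    rw [h]
    exact Ideal.add_mem _ (Ideal.mul_mem_left _ _ hv) hu
  inv_mem' := by
    intro u hu
    have h : ((u⁻¹ : (IntGroupRing G)ˣ) : IntGroupRing G) - 1
        = -((u⁻¹ : (IntGroupRing G)ˣ) : IntGroupRing G) * ((u : IntGroupRing G) - 1) := by
      simp [mul_sub]; abel
    simp only [Set.mem_ofPred_eq] at hu ⊢
    rw [h]
    exact Ideal.mul_mem_left _ _ hu

/-- The filtration `Vₙ(ℤG) = V(ℤG) ∩ (1 + Δⁿ(G))`. -/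
noncomputable def unitFiltration (G : Type*) [Group G] (n : ℕ) : Subgroup (IntGroupRing G)ˣ :=
  normalizedUnits G ⊓ deltaUnits G n

/-- `G` is a cut-group: all central units of `ℤG` are trivial, that is, of the form `±g`. -/
def IsCutGroup (G : Type*) [Group G] : Prop :=
  ∀ u : (IntGroupRing G)ˣ, (u : IntGroupRing G) ∈ Set.center (IntGroupRing G) →
    ∃ g : G, (u : IntGroupRing G) = MonoidAlgebra.of ℤ G g ∨
      (u : IntGroupRing G) = -MonoidAlgebra.of ℤ G g

/-!
Triviality of `Vₙ` passes to subgroups, and some power of every normalized unit of a finite group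
lies in `Vₙ`. Bass units of infinite order therefore restrict the orders of the elements of `G` to
divisors of 4 and 6. A bicyclic unit `1 + (g - 1) * h * N`, where `N` is the sum of the powers of
`g`, also has a power in `Vₙ`, so `(g - 1) * h * N = 0` and every cyclic subgroup is normal.
Conjugation thus fixes or inverts each element. It follows that two noncommuting elements generate
a quaternion group of order 8 and that its centralizer, of exponent dividing 2, supplies the
complement `E`.

Conversely, Parseval's identity bounds the coefficients of a unit: the values of a character of
exponent 4 or 6 lie in an imaginary quadratic order, and those of the representation of `K₈` in
Hamilton's quaternions over `ℤ`, where units have norm one. A factor `C₂` is absorbed by comparing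
the two projections `ℤ[G × C₂] → ℤG` modulo 2. Finally, coordinates on `G` which are polynomial
maps of degree less than `n` show that `1` is the only element of `G` in `1 + Δⁿ`, with `n = 2`
for abelian groups and `n = 3` for `K₈ × E`.
-/

open MonoidAlgebra

section Augmentation

variable {G H : Type*} [Group G] [Group H]

theorem augmentation_single (g : G) (r : ℤ) : augmentation G (single g r) = r := by
  simp [augmentation]

theorem augmentation_of (g : G) : augmentation G (of ℤ G g) = 1 :=
  augmentation_single g 1

theorem augmentation_mapDomainRingHom (f : G →* H) (x : IntGroupRing G) :
    augmentation H (mapDomainRingHom ℤ f x) = augmentation G x := by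
  induction x using MonoidAlgebra.induction_linear with
  | zero => simp
  | add x y hx hy => simp only [map_add, hx, hy]
  | single g r => simp [augmentation_single]

theorem mem_augIdeal {x : IntGroupRing G} : x ∈ augIdeal G ↔ augmentation G x = 0 :=
  RingHom.mem_ker

instance augIdeal_isTwoSided : (augIdeal G).IsTwoSided :=
  inferInstanceAs (RingHom.ker (augmentation G)).IsTwoSided

theorem of_sub_one_mem_augIdeal (g : G) : of ℤ G g - 1 ∈ augIdeal G := by
  rw [mem_augIdeal, map_sub, augmentation_of, map_one, sub_self]

theorem augIdeal_eq_span : augIdeal G = Ideal.span (Set.range fun g => of ℤ G g - 1) := by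
  refine le_antisymm (fun x hx => ?_) ?_
  · suffices h : x - (augmentation G x : IntGroupRing G) ∈
        Ideal.span (Set.range fun g => of ℤ G g - 1) by
      rwa [mem_augIdeal.1 hx, Int.cast_zero, sub_zero] at h
    clear hx
    induction x using MonoidAlgebra.induction_linear with
    | zero => simp
    | add x y hx hy =>
      rw [map_add, Int.cast_add, add_sub_add_comm]
      exact add_mem hx hy
    | single g r =>
      have h : single g r - (augmentation G (single g r) : IntGroupRing G) =
          (r : IntGroupRing G) * (of ℤ G g - 1) := by
        rw [augmentation_single, mul_sub, mul_one, single_eq_algebraMap_mul_of, eq_intCast]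
      rw [h]
      exact Ideal.mul_mem_left _ _ (Ideal.subset_span ⟨g, rfl⟩)
  · rw [Ideal.span_le]
    rintro - ⟨g, rfl⟩
    exact of_sub_one_mem_augIdeal g

theorem mapDomainRingHom_mem_augIdeal_pow (f : G →* H) {n : ℕ} {x : IntGroupRing G}
    (hx : x ∈ augIdeal G ^ n) : mapDomainRingHom ℤ f x ∈ augIdeal H ^ n := by
  induction n generalizing x with
  | zero => rw [Submodule.pow_zero, Ideal.one_eq_top]; trivial
  | succ n ih =>
    rw [Submodule.pow_succ] at hx ⊢
    induction hx using Submodule.mul_induction_on' with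
    | mem_mul_mem a ha b hb =>
      rw [map_mul]
      refine Ideal.mul_mem_mul (ih ha) ?_
      rwa [mem_augIdeal, augmentation_mapDomainRingHom, ← mem_augIdeal]
    | add a _ b _ ha hb => rw [map_add]; exact add_mem ha hb

theorem mem_normalizedUnits {u : (IntGroupRing G)ˣ} :
    u ∈ normalizedUnits G ↔ augmentation G (u : IntGroupRing G) = 1 := by
  rw [normalizedUnits, MonoidHom.mem_ker, Units.ext_iff]
  rfl

theorem mem_unitFiltration {u : (IntGroupRing G)ˣ} {n : ℕ} :
    u ∈ unitFiltration G n ↔ u ∈ normalizedUnits G ∧ (u : IntGroupRing G) - 1 ∈ augIdeal G ^ n :=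
  Iff.rfl

theorem unitFiltration_eq_bot_of_injective {f : H →* G} (hf : Function.Injective f) {n : ℕ}
    (h : unitFiltration G n = ⊥) : unitFiltration H n = ⊥ := by
  have hF : Function.Injective (mapDomainRingHom ℤ f) := mapDomain_injective hf
  refine (Subgroup.eq_bot_iff_forall _).2 fun u hu => ?_
  obtain ⟨hu1, hun⟩ := mem_unitFiltration.1 hu
  have hmem : Units.map (mapDomainRingHom ℤ f : IntGroupRing H →* IntGroupRing G) u ∈
      unitFiltration G n := by
    refine mem_unitFiltration.2 ⟨?_, ?_⟩
    · rw [mem_normalizedUnits] at hu1 ⊢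
      exact (augmentation_mapDomainRingHom f _).trans hu1
    · have hmap := mapDomainRingHom_mem_augIdeal_pow f hun
      rwa [map_sub, map_one] at hmap
  rw [h, Subgroup.mem_bot] at hmem
  exact Units.map_injective hF (hmem.trans (map_one _).symm)

theorem pow_nsmul_of_sub_one_mem_augIdeal_pow {e : ℕ} {g : G} (hg : g ^ e = 1) (n : ℕ) :
    e ^ n • (of ℤ G g - 1) ∈ augIdeal G ^ (n + 1) := by
  induction n with
  | zero => simpa only [pow_zero, one_smul, zero_add, Submodule.pow_one] using
      of_sub_one_mem_augIdeal g
  | succ n ih =>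
    have hsum : (∑ i ∈ Finset.range e, of ℤ G g ^ i) * (of ℤ G g - 1) = 0 := by
      rw [geom_sum_mul, ← map_pow, hg, map_one, sub_self]
    have hsmul : e • (of ℤ G g - 1) =
        -(∑ i ∈ Finset.range e, (of ℤ G (g ^ i) - 1)) * (of ℤ G g - 1) := by
      simp only [map_pow, Finset.sum_sub_distrib, neg_sub, sub_mul _ _ (of ℤ G g - 1), hsum]
      simp
    rw [pow_succ, mul_smul, hsmul, ← mul_smul_comm, Submodule.pow_succ' _ n.succ_ne_zero]
    exact Ideal.mul_mem_mul (neg_mem (sum_mem fun i _ => of_sub_one_mem_augIdeal _)) ih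

theorem pow_nsmul_mem_augIdeal_pow {e : ℕ} (he : ∀ g : G, g ^ e = 1) (n : ℕ)
    {x : IntGroupRing G} (hx : x ∈ augIdeal G) : e ^ n • x ∈ augIdeal G ^ (n + 1) := by
  rw [augIdeal_eq_span] at hx
  induction hx using Submodule.span_induction with
  | mem x hx =>
    obtain ⟨g, rfl⟩ := hx
    exact pow_nsmul_of_sub_one_mem_augIdeal_pow (he g) n
  | zero => simp
  | add x y _ _ hx hy => rw [smul_add]; exact add_mem hx hy
  | smul a x _ hx => rw [smul_eq_mul, ← mul_smul_comm]; exact Ideal.mul_mem_left _ _ hx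

theorem exists_pow_eq_one_add_nsmul [Finite G] (u : (IntGroupRing G)ˣ) (N : ℕ) [NeZero N] :
    ∃ k, 0 < k ∧ ∃ x : IntGroupRing G, (u : IntGroupRing G) ^ k = 1 + N • x := by
  let φ := mapRingHom G (Int.castRingHom (ZMod N))
  have : Finite (MonoidAlgebra (ZMod N) G) :=
    Finite.of_injective (fun x => (x.coeff : G → ZMod N))
      (DFunLike.coe_injective.comp coeff_injective)
  obtain ⟨k, hk, h⟩ := (isOfFinOrder_of_finite (Units.map φ.toMonoidHom u)).exists_pow_eq_one
  refine ⟨k, hk, ?_⟩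
  have hφ : φ ((u : IntGroupRing G) ^ k - 1) = 0 := by
    have := congrArg Units.val h
    rw [map_sub, map_pow, map_one, sub_eq_zero]
    simpa using this
  generalize hy : (u : IntGroupRing G) ^ k - 1 = y at hφ
  have hdvd : ∀ g, (N : ℤ) ∣ y.coeff g := by
    intro g
    rw [← ZMod.intCast_zmod_eq_zero_iff_dvd]
    have := congrArg (fun y => y.coeff g) hφ
    simpa [φ] using this
  refine ⟨ofCoeff (y.coeff.mapRange (· / (N : ℤ)) (by simp)), ?_⟩
  rw [← sub_eq_iff_eq_add', hy]
  ext g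
  rw [coeff_smul_apply, Finsupp.mapRange_apply, nsmul_eq_mul]
  exact (Int.mul_ediv_cancel' (hdvd g)).symm

theorem exists_pow_mem_unitFiltration [Finite G] {u : (IntGroupRing G)ˣ}
    (hu : u ∈ normalizedUnits G) (n : ℕ) : ∃ k, 0 < k ∧ u ^ k ∈ unitFiltration G n := by
  have : NeZero (Nat.card G ^ n) := ⟨pow_ne_zero n Nat.card_pos.ne'⟩
  obtain ⟨k, hk, x, hx⟩ := exists_pow_eq_one_add_nsmul u (Nat.card G ^ n)
  have hx0 : x ∈ augIdeal G := by
    have := congrArg (augmentation G) hx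
    rw [map_pow, mem_normalizedUnits.1 hu, map_add, map_nsmul, one_pow, map_one, left_eq_add,
      smul_eq_zero] at this
    exact mem_augIdeal.2 (this.resolve_left (NeZero.ne _))
  refine ⟨k, hk, mem_unitFiltration.2 ⟨pow_mem hu k, Ideal.pow_le_pow_right n.le_succ ?_⟩⟩
  rw [Units.val_pow_eq_pow_val, hx, add_sub_cancel_left]
  exact pow_nsmul_mem_augIdeal_pow (fun g => pow_card_eq_one') n hx0

theorem isOfFinOrder_of_unitFiltration_eq_bot [Finite G] {n : ℕ} (h : unitFiltration G n = ⊥)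
    {u : (IntGroupRing G)ˣ} (hu : u ∈ normalizedUnits G) : IsOfFinOrder u := by
  obtain ⟨k, hk, hmem⟩ := exists_pow_mem_unitFiltration hu n
  rw [h, Subgroup.mem_bot] at hmem
  exact isOfFinOrder_iff_pow_eq_one.2 ⟨k, hk, hmem⟩

end Augmentation

section BassUnits

variable {R R' : Type*} [CommRing R] [CommRing R']

theorem isUnit_of_mul_eq_self_of_dvd {x y s : R} (hs : x * s = s) (hdvd : s ∣ x * y - 1) :
    IsUnit x := by
  obtain ⟨r, hr⟩ := hdvd
  exact IsUnit.of_mul_eq_one (y - s * r) (by linear_combination hr - r * hs)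

theorem geom_sum_mul_geom_sum_pow (t : R) (k l : ℕ) :
    (∑ i ∈ Finset.range k, t ^ i) * ∑ j ∈ Finset.range l, (t ^ k) ^ j =
      ∑ i ∈ Finset.range (k * l), t ^ i := by
  induction l with
  | zero => simp
  | succ l ih =>
    rw [Finset.sum_range_succ, mul_add, ih, mul_add_one, Finset.sum_range_add, ← pow_mul,
      mul_comm _ (t ^ _), Finset.mul_sum]
    simp only [pow_add]

theorem geom_sum_dvd_geom_sum_sub_one (t : R) {n m : ℕ} (h : m ≡ 1 [MOD n]) (hm : m ≠ 0) :
    ∑ i ∈ Finset.range n, t ^ i ∣ ∑ i ∈ Finset.range m, t ^ i - 1 := by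
  obtain ⟨m, rfl⟩ := Nat.exists_eq_succ_of_ne_zero hm
  obtain ⟨q, rfl⟩ : n ∣ m := by simpa using (Nat.modEq_iff_dvd' (by simp)).1 h.symm
  rw [geom_sum_succ, add_sub_cancel_right, ← geom_sum_mul_geom_sum_pow]
  exact (dvd_mul_right _ _).mul_left t

theorem geom_sum_mul_geom_sum_of_pow_eq_one {t : R} {n : ℕ} (ht : t ^ n = 1) (k : ℕ) :
    (∑ i ∈ Finset.range k, t ^ i) * ∑ i ∈ Finset.range n, t ^ i =
      k * ∑ i ∈ Finset.range n, t ^ i := by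
  have hfix : t * ∑ i ∈ Finset.range n, t ^ i = ∑ i ∈ Finset.range n, t ^ i := by
    linear_combination mul_geom_sum t n + ht
  induction k with
  | zero => simp
  | succ k ih =>
    rw [geom_sum_succ, add_mul, mul_right_comm, hfix, mul_comm, ih, Nat.cast_succ]
    ring

/-- The Bass element `(1 + t + ⋯ + t ^ (k - 1)) ^ m + c (1 + t + ⋯ + t ^ (n - 1))`, where
`c = (1 - k ^ m) / n`. The division is exact for `k ^ m ≡ 1 [MOD n]`, the case of interest: then
the element is a unit of augmentation one if `t` is a group element with `t ^ n = 1`. -/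
def bassElement (t : R) (n k m : ℕ) : R :=
  (∑ i ∈ Finset.range k, t ^ i) ^ m + ((1 - (k : ℤ) ^ m) / n : ℤ) * ∑ i ∈ Finset.range n, t ^ i

theorem map_bassElement (f : R →+* R') (t : R) (n k m : ℕ) :
    f (bassElement t n k m) = bassElement (f t) n k m := by
  simp [bassElement]

theorem bassElement_one {n k m : ℕ} (h : k ^ m ≡ 1 [MOD n]) : bassElement (1 : R) n k m = 1 := by
  have hdvd : (n : ℤ) ∣ 1 - (k : ℤ) ^ m := by exact_mod_cast Nat.modEq_iff_dvd.1 h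
  have hc := congrArg (Int.cast : ℤ → R) (Int.ediv_mul_cancel hdvd)
  push_cast at hc
  simp only [bassElement, one_pow, Finset.sum_const, Finset.card_range, nsmul_eq_mul, mul_one]
  rw [hc, add_sub_cancel]

theorem isUnit_bassElement {t : R} {n k m : ℕ} (ht : t ^ n = 1) (hk : k ≠ 0) (hm : m ≠ 0)
    (h : k ^ m ≡ 1 [MOD n]) : IsUnit (bassElement t n k m) := by
  have hone := bassElement_one (R := R) h
  have hinv := geom_sum_dvd_geom_sum_sub_one t h (pow_ne_zero m hk)
  have hmul := geom_sum_mul_geom_sum_of_pow_eq_one ht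
  rw [← mul_pow_sub_one hm, ← geom_sum_mul_geom_sum_pow] at hinv
  simp only [bassElement, one_pow, Finset.sum_const, Finset.card_range, nsmul_eq_mul,
    mul_one] at hone
  rw [bassElement]
  set c : R := (((1 - (k : ℤ) ^ m) / n : ℤ) : R)
  set A := ∑ i ∈ Finset.range k, t ^ i
  set B := ∑ j ∈ Finset.range (k ^ (m - 1)), (t ^ k) ^ j
  set S := ∑ i ∈ Finset.range n, t ^ i
  have hA : A ^ m * S = (k : R) ^ m * S := by
    clear hone hinv h hm
    induction m with
    | zero => simp
    | succ m ih => linear_combination A * ih + (k : R) ^ m * hmul k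
  refine isUnit_of_mul_eq_self_of_dvd (y := B ^ m) (s := S) ?_ ?_
  · linear_combination hA + c * hmul n + S * hone
  · have hpow : S ∣ (A * B) ^ m - 1 ^ m := hinv.trans (sub_dvd_pow_sub_pow _ _ m)
    convert hpow.add ((dvd_mul_left S (c * B ^ m))) using 1
    ring

end BassUnits

section RootsOfUnity

open scoped ComplexConjugate

theorem eq_or_mul_eq_one_of_norm_sub_one_eq {z w : ℂ} (hz : ‖z‖ = 1) (hw : ‖w‖ = 1)
    (h : ‖z - 1‖ = ‖w - 1‖) : z = w ∨ z * w = 1 := by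
  have hz' : z * conj z = 1 := by rw [Complex.mul_conj']; simp [hz]
  have hw' : w * conj w = 1 := by rw [Complex.mul_conj']; simp [hw]
  have h' : (z - 1) * conj (z - 1) = (w - 1) * conj (w - 1) := by
    rw [Complex.mul_conj', Complex.mul_conj', h]
  rw [map_sub, map_sub, map_one] at h'
  have hprod : (z - w) * (z * w - 1) = 0 := by
    linear_combination (z * w - w) * hz' - (z * w - z) * hw' - z * w * h'
  simpa only [mul_eq_zero, sub_eq_zero] using hprod

theorem norm_geom_sum_ne_one_of_isPrimitiveRoot {n k : ℕ} {ζ : ℂ} (hζ : IsPrimitiveRoot ζ n)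
    (h1 : 1 < k) (hk : k + 1 < n) : ‖∑ i ∈ Finset.range k, ζ ^ i‖ ≠ 1 := by
  intro h
  have hnorm : ‖ζ‖ = 1 := hζ.norm'_eq_one (by omega)
  have hsub : ‖ζ ^ k - 1‖ = ‖ζ - 1‖ := by rw [← geom_sum_mul, norm_mul, h, one_mul]
  rcases eq_or_mul_eq_one_of_norm_sub_one_eq (by rw [norm_pow, hnorm, one_pow]) hnorm hsub
    with hk1 | hk1
  · have := hζ.pow_inj (i := k) (j := 1) (by omega) (by omega) (by rw [hk1, pow_one])
    omega
  · rw [← pow_succ] at hk1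
    exact absurd (Nat.le_of_dvd (by omega) (hζ.dvd_of_pow_eq_one _ hk1)) (by omega)

theorem exists_coprime_lt_of_not_dvd {n : ℕ} (hn : n ≠ 0) (h4 : ¬ n ∣ 4) (h6 : ¬ n ∣ 6) :
    ∃ k, 1 < k ∧ k + 1 < n ∧ k.Coprime n := by
  have h5 : 5 ≤ n ∧ n ≠ 6 := by
    refine ⟨?_, fun h => h6 (h ▸ dvd_rfl)⟩
    by_contra!
    interval_cases n <;> simp_all
  rcases Nat.even_or_odd' n with ⟨m, rfl | rfl⟩
  · rcases Nat.even_or_odd' m with ⟨j, rfl | rfl⟩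
    · refine ⟨2 * j - 1, by omega, by omega, ?_⟩
      have hcop : (2 * j - 1).Coprime (2 * j) := by
        simpa [show 2 * j - 1 + 1 = 2 * j by omega] using
          Nat.coprime_self_add_right (m := 2 * j - 1) (n := 1)
      exact Nat.Coprime.mul_right (hcop.coprime_mul_right_right) hcop
    · refine ⟨2 * j - 1, by omega, by omega, ?_⟩
      have hodd : (2 * j - 1).Coprime 2 := Nat.coprime_two_right.2 ⟨j - 1, by omega⟩
      refine hodd.mul_right ?_
      rw [show 2 * j + 1 = 2 * j - 1 + 2 by omega]
      exact Nat.coprime_self_add_right.2 hodd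
  · exact ⟨2, by omega, by omega, by simp⟩

end RootsOfUnity

section CyclicGroups

theorem not_isOfFinOrder_of_norm_map_ne_one {R : Type*} [Ring R] (χ : R →+* ℂ) {u : Rˣ}
    (h : ‖χ u‖ ≠ 1) : ¬ IsOfFinOrder u := by
  intro hu
  exact h ((χ : R →* ℂ).isOfFinOrder (Units.isOfFinOrder_val.2 hu)).norm_eq_one

theorem exists_mem_normalizedUnits_not_isOfFinOrder {C : Type*} [CommGroup C] {g : C}
    (hgen : ∀ x : C, x ∈ Subgroup.zpowers g) (hg : IsOfFinOrder g) (h4 : ¬ orderOf g ∣ 4)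
    (h6 : ¬ orderOf g ∣ 6) : ∃ u ∈ normalizedUnits C, ¬ IsOfFinOrder u := by
  set n := orderOf g
  have hn0 : n ≠ 0 := hg.orderOf_pos.ne'
  obtain ⟨k, hk1, hkn, hcop⟩ := exists_coprime_lt_of_not_dvd hn0 h4 h6
  have htot : n.totient ≠ 0 := (Nat.totient_pos.2 hg.orderOf_pos).ne'
  have hmod : k ^ n.totient ≡ 1 [MOD n] := Nat.ModEq.pow_totient hcop
  have hgn : of ℤ C g ^ n = 1 := by rw [← map_pow, pow_orderOf_eq_one, map_one]
  obtain ⟨u, hu⟩ := isUnit_bassElement hgn (by omega) htot hmod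
  refine ⟨u, ?_, ?_⟩
  · rw [mem_normalizedUnits, hu]
    refine (map_bassElement (augmentation C : IntGroupRing C →+* ℤ) _ _ _ _).trans ?_
    rw [RingHom.coe_coe, augmentation_of, bassElement_one hmod]
  · have hζ := Complex.isPrimitiveRoot_exp n hn0
    set ζ := Complex.exp (2 * Real.pi * Complex.I / n)
    have hdvd : orderOf (hζ.isUnit hn0).unit ∣ orderOf g := by
      rw [← orderOf_units, IsUnit.unit_spec, ← hζ.eq_orderOf]
    let χ : IntGroupRing C →ₐ[ℤ] ℂ := MonoidAlgebra.lift ℤ ℂ C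
      ((Units.coeHom ℂ).comp (monoidHomOfForallMemZpowers hgen hdvd))
    have hχg : χ (of ℤ C g) = ζ := by
      rw [lift_of, MonoidHom.comp_apply, monoidHomOfForallMemZpowers_apply_gen]
      rfl
    have hχu : χ (u : IntGroupRing C) = (∑ i ∈ Finset.range k, ζ ^ i) ^ n.totient := by
      rw [hu]
      refine (map_bassElement (χ : IntGroupRing C →+* ℂ) _ _ _ _).trans ?_
      rw [RingHom.coe_coe, hχg, bassElement, hζ.geom_sum_eq_zero (by omega), mul_zero, add_zero]
    refine not_isOfFinOrder_of_norm_map_ne_one (χ : IntGroupRing C →+* ℂ) ?_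
    rw [RingHom.coe_coe, hχu, norm_pow, Ne, pow_eq_one_iff_of_nonneg (norm_nonneg _) htot]
    exact norm_geom_sum_ne_one_of_isPrimitiveRoot hζ hk1 hkn

theorem orderOf_dvd_four_or_six_of_unitFiltration_eq_bot {G : Type*} [Group G] {n : ℕ}
    (h : unitFiltration G n = ⊥) {g : G} (hg : IsOfFinOrder g) :
    orderOf g ∣ 4 ∨ orderOf g ∣ 6 := by
  by_contra! hdvd
  let γ : Subgroup.zpowers g := ⟨g, Subgroup.mem_zpowers g⟩
  have hγ : orderOf γ = orderOf g := Subgroup.orderOf_mk g _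
  have hgen : ∀ x : Subgroup.zpowers g, x ∈ Subgroup.zpowers γ := by
    rintro ⟨-, i, rfl⟩
    exact ⟨i, rfl⟩
  have : Finite (Subgroup.zpowers g) := (finite_zpowers.2 hg).to_subtype
  have hbot := unitFiltration_eq_bot_of_injective (Subgroup.zpowers g).subtype_injective h
  let _ : CommGroup (Subgroup.zpowers g) := { Subgroup.toGroup _ with mul_comm := mul_comm' }
  rw [← hγ] at hdvd
  obtain ⟨u, hu, hinf⟩ := exists_mem_normalizedUnits_not_isOfFinOrder hgen
    (isOfFinOrder_of_finite γ) hdvd.1 hdvd.2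
  exact hinf (isOfFinOrder_of_unitFiltration_eq_bot hbot hu)

end CyclicGroups

section TrivialUnits

variable {G H : Type*} [Group G] [Group H]

/-- All units of `ℤG` are of the form `±g`, that is, `IsCutGroup` without the restriction to
central units. The two notions agree for abelian groups. -/
def HasTrivialUnits (G : Type*) [Group G] : Prop :=
  ∀ u : (IntGroupRing G)ˣ, ∃ g : G, (u : IntGroupRing G) = of ℤ G g ∨
    (u : IntGroupRing G) = -of ℤ G g

theorem isCutGroup_iff_hasTrivialUnits (hcomm : ∀ a b : G, a * b = b * a) :
    IsCutGroup G ↔ HasTrivialUnits G := by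
  let _ : CommGroup G := { ‹Group G› with mul_comm := hcomm }
  exact ⟨fun h u => h u (by rw [Set.center_eq_univ]; trivial), fun h u _ => h u⟩

theorem HasTrivialUnits.of_injective {f : H →* G} (hf : Function.Injective f)
    (h : HasTrivialUnits G) : HasTrivialUnits H := by
  classical
  have hF : Function.Injective (mapDomainRingHom ℤ f) := mapDomain_injective hf
  intro u
  obtain ⟨g, hg⟩ := h (Units.map (mapDomainRingHom ℤ f : IntGroupRing H →* IntGroupRing G) u)
  replace hg : mapDomainRingHom ℤ f u = of ℤ G g ∨ mapDomainRingHom ℤ f u = -of ℤ G g := hg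
  obtain ⟨k, rfl⟩ : g ∈ Set.range f := by
    by_contra hrange
    have hzero : (mapDomainRingHom ℤ f u).coeff g = 0 :=
      Finsupp.mapDomain_of_notMem_range _ _ hrange
    rcases hg with hg | hg <;> simp [hg] at hzero
  have hof : mapDomainRingHom ℤ f (of ℤ H k) = of ℤ G (f k) := by simp
  refine ⟨k, hg.imp (fun hk => hF (hk.trans hof.symm)) fun hk => hF ?_⟩
  rw [hk, map_neg, hof]

theorem HasTrivialUnits.of_forall_fg (h : ∀ K : Subgroup G, K.FG → HasTrivialUnits K) :
    HasTrivialUnits G := by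
  classical
  intro u
  let s := (u : IntGroupRing G).coeff.support ∪ (↑u⁻¹ : IntGroupRing G).coeff.support
  let K := Subgroup.closure (s : Set G)
  have hrange : (s : Set G) ⊆ Set.range K.subtype := by
    simp [K]
  have hF : Function.Injective (mapDomainRingHom ℤ K.subtype) :=
    mapDomain_injective K.subtype_injective
  obtain ⟨v, hv⟩ : ∃ v, mapDomainRingHom ℤ K.subtype v = u :=
    ⟨_, mapDomain_comapDomain ((Finset.coe_subset.2 Finset.subset_union_left).trans hrange)
      K.subtype_injective⟩
  obtain ⟨w, hw⟩ : ∃ w, mapDomainRingHom ℤ K.subtype w = (↑u⁻¹ : IntGroupRing G) :=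
    ⟨_, mapDomain_comapDomain ((Finset.coe_subset.2 Finset.subset_union_right).trans hrange)
      K.subtype_injective⟩
  have hvw : v * w = 1 := hF (by rw [map_mul, hv, hw, Units.mul_inv, map_one])
  have hwv : w * v = 1 := hF (by rw [map_mul, hv, hw, Units.inv_mul, map_one])
  obtain ⟨k, hk : v = of ℤ K k ∨ v = -of ℤ K k⟩ := h K ⟨s, rfl⟩ ⟨v, w, hvw, hwv⟩
  have hof : mapDomainRingHom ℤ K.subtype (of ℤ K k) = of ℤ G k := by simp
  refine ⟨k, hk.imp (fun hk => ?_) fun hk => ?_⟩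
  · rw [← hv, hk, hof]
  · rw [← hv, hk, map_neg, hof]

theorem exists_eq_of_sum_sq_coeff_eq_one [Fintype G] {x : IntGroupRing G}
    (h : ∑ g, x.coeff g ^ 2 = 1) : ∃ g : G, x = of ℤ G g ∨ x = -of ℤ G g := by
  classical
  obtain ⟨g, -, hg⟩ := Finset.exists_ne_zero_of_sum_ne_zero (h.trans_ne one_ne_zero)
  rw [← Finset.add_sum_erase _ _ (Finset.mem_univ g)] at h
  have hnonneg : 0 ≤ ∑ k ∈ Finset.univ.erase g, x.coeff k ^ 2 :=
    Finset.sum_nonneg fun k _ => sq_nonneg _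
  have hpos : 0 < x.coeff g ^ 2 := lt_of_le_of_ne (sq_nonneg _) (Ne.symm hg)
  have hsq : x.coeff g ^ 2 = 1 := by omega
  have hrest : ∑ k ∈ Finset.univ.erase g, x.coeff k ^ 2 = 0 := by omega
  rw [Finset.sum_eq_zero_iff_of_nonneg fun k _ => sq_nonneg _] at hrest
  have hx : x = single g (x.coeff g) := by
    ext k
    by_cases hk : k = g
    · subst hk; simp
    · rw [coeff_single, Finsupp.single_eq_of_ne hk]
      exact sq_eq_zero_iff.1 (hrest k (by simp [hk]))
  refine ⟨g, (sq_eq_one_iff.1 hsq).imp (fun h => ?_) fun h => ?_⟩ <;> rw [hx, h]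
  · rfl
  · ext; simp

end TrivialUnits

section Characters

open scoped ComplexConjugate

theorem sum_normSq_sum_mul_addChar {A : Type*} [AddCommGroup A] [Fintype A] (f : A → ℂ) :
    ∑ ψ : AddChar A ℂ, Complex.normSq (∑ a, f a * ψ a) =
      Fintype.card A * ∑ a, Complex.normSq (f a) := by
  classical
  have hψ : ∀ ψ : AddChar A ℂ, (Complex.normSq (∑ a, f a * ψ a) : ℂ) =
      ∑ a, ∑ b, f a * conj (f b) * ψ (a - b) := by
    intro ψ
    rw [← Complex.mul_conj, map_sum, Finset.sum_mul_sum]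
    refine Finset.sum_congr rfl fun a _ => Finset.sum_congr rfl fun b _ => ?_
    rw [sub_eq_add_neg, AddChar.map_add_eq_mul, AddChar.map_neg_eq_conj, map_mul]
    ring
  apply Complex.ofReal_injective
  push_cast
  simp_rw [hψ]
  rw [Finset.sum_comm]
  simp_rw [Finset.sum_comm (s := (Finset.univ : Finset (AddChar A ℂ))), ← Finset.mul_sum,
    AddChar.sum_apply_eq_ite, sub_eq_zero]
  simp [Complex.mul_conj, Finset.mul_sum, mul_comm]

theorem lift_apply_eq_sum {G A : Type*} [Group G] [Fintype G] [Ring A] [Algebra ℤ A] (f : G →* A)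
    (x : IntGroupRing G) : MonoidAlgebra.lift ℤ A G f x = ∑ g, (x.coeff g : A) * f g := by
  simp only [MonoidAlgebra.lift_apply', eq_intCast]
  exact Finsupp.sum_fintype _ _ fun g => by rw [Int.cast_zero, zero_mul]

variable {G : Type*} [CommGroup G]

/-- The extension of a complex character of the abelian group `G`, written as an additive
character of `Additive G`, to a ring homomorphism `ℤG → ℂ`. -/
noncomputable def charEval (ψ : AddChar (Additive G) ℂ) : IntGroupRing G →ₐ[ℤ] ℂ :=
  MonoidAlgebra.lift ℤ ℂ G
    (ψ.toMonoidHom.comp (MulEquiv.multiplicativeAdditive G).symm.toMonoidHom)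

theorem charEval_single (ψ : AddChar (Additive G) ℂ) (g : G) (r : ℤ) :
    charEval ψ (single g r) = r * ψ (.ofMul g) := by
  rw [charEval, lift_single, zsmul_eq_mul]
  rfl

theorem charEval_apply [Fintype G] (ψ : AddChar (Additive G) ℂ) (x : IntGroupRing G) :
    charEval ψ x = ∑ g : Additive G, (x.coeff g.toMul : ℂ) * ψ g :=
  (lift_apply_eq_sum _ x).trans (Fintype.sum_equiv Additive.ofMul _ _ fun _ => rfl)

theorem sum_normSq_charEval [Fintype G] (x : IntGroupRing G) :
    ∑ ψ : AddChar (Additive G) ℂ, Complex.normSq (charEval ψ x) =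
      Fintype.card G * ∑ g, (x.coeff g : ℝ) ^ 2 := by
  simp_rw [charEval_apply, sum_normSq_sum_mul_addChar, Complex.normSq_intCast, ← sq,
    Fintype.card_congr (Additive.toMul (α := G))]
  congr 1
  exact Fintype.sum_equiv Additive.toMul _ _ fun _ => rfl

theorem charEval_mem (S : Subalgebra ℤ ℂ) {ψ : AddChar (Additive G) ℂ} (hψ : ∀ a, ψ a ∈ S)
    (x : IntGroupRing G) : charEval ψ x ∈ S := by
  induction x using MonoidAlgebra.induction_linear with
  | zero => simp
  | add x y hx hy => rw [map_add]; exact add_mem hx hy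
  | single g r => rw [charEval_single]; exact mul_mem (intCast_mem S r) (hψ _)

end Characters

section AbelianGroups

theorem exists_eq_add_mul_of_mem_adjoin {R : Type*} [CommRing R] {ω : R} {s t : ℤ}
    (hω : ω ^ 2 = s + t * ω) {z : R} (hz : z ∈ Algebra.adjoin ℤ {ω}) :
    ∃ a b : ℤ, z = a + b * ω := by
  induction hz using Algebra.adjoin_induction with
  | mem x hx => exact ⟨0, 1, by simpa using hx⟩
  | algebraMap r => exact ⟨r, 0, by simp⟩
  | add x y _ _ hx hy =>
    obtain ⟨a, b, rfl⟩ := hx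
    obtain ⟨c, d, rfl⟩ := hy
    exact ⟨a + c, b + d, by push_cast; ring⟩
  | mul x y _ _ hx hy =>
    obtain ⟨a, b, rfl⟩ := hx
    obtain ⟨c, d, rfl⟩ := hy
    exact ⟨a * c + b * d * s, a * d + b * c + b * d * t, by
      push_cast; linear_combination (b * d : R) * hω⟩

theorem exists_nat_normSq_eq_of_mem_adjoin {ω : ℂ} (hω : ‖ω‖ = 1) {t : ℤ} (ht : 2 * ω.re = t)
    {z : ℂ} (hz : z ∈ Algebra.adjoin ℤ {ω}) : ∃ m : ℕ, Complex.normSq z = m := by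
  have hnorm : ω.re ^ 2 + ω.im ^ 2 = 1 := by
    rw [sq, sq, ← Complex.normSq_apply, Complex.normSq_eq_norm_sq, hω, one_pow]
  have hquad : ω ^ 2 = (-1 : ℤ) + t * ω := by
    apply Complex.ext
    · simp [sq]; linear_combination ω.re * ht - hnorm
    · simp [sq]; linear_combination ω.im * ht
  obtain ⟨a, b, rfl⟩ := exists_eq_add_mul_of_mem_adjoin hquad hz
  have hform : Complex.normSq (a + b * ω) = ((a ^ 2 + t * a * b + b ^ 2 : ℤ) : ℝ) := by
    simp only [Complex.normSq_apply, Complex.add_re, Complex.add_im, Complex.mul_re,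
      Complex.mul_im, Complex.intCast_re, Complex.intCast_im]
    push_cast
    linear_combination (b : ℝ) ^ 2 * hnorm + a * b * ht
  have hnonneg : 0 ≤ a ^ 2 + t * a * b + b ^ 2 := by
    have := Complex.normSq_nonneg (a + b * ω)
    rw [hform] at this
    exact_mod_cast this
  obtain ⟨m, hm⟩ := Int.eq_ofNat_of_zero_le hnonneg
  exact ⟨m, by rw [hform, hm, Int.cast_natCast]⟩

variable {G : Type*} [CommGroup G]

theorem exists_eq_of_forall_normSq_charEval_eq_one [Finite G] {x : IntGroupRing G}
    (h : ∀ ψ, Complex.normSq (charEval ψ x) = 1) : ∃ g : G, x = of ℤ G g ∨ x = -of ℤ G g := by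
  have := Fintype.ofFinite G
  apply exists_eq_of_sum_sq_coeff_eq_one
  have hsum := sum_normSq_charEval x
  simp only [h, Finset.sum_const, Finset.card_univ, AddChar.card_eq, nsmul_one,
    Fintype.card_congr (Additive.toMul (α := G))] at hsum
  have hcard : (Fintype.card G : ℝ) ≠ 0 := by exact_mod_cast Fintype.card_ne_zero
  exact_mod_cast (mul_left_cancel₀ hcard ((mul_one _).trans hsum)).symm

/-- The values of a character of exponent `e` lie in `ℤ[ω] = ℤ + ℤω`, where `ω = exp (2πi / e)`,
and the squared absolute value is integral there, so units have absolute value one. -/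
theorem hasTrivialUnits_of_two_mul_cos_eq_int [Finite G] {e : ℕ} (he : e ≠ 0) {t : ℤ}
    (ht : 2 * Real.cos (2 * Real.pi / e) = t) (hG : ∀ g : G, g ^ e = 1) : HasTrivialUnits G := by
  intro u
  refine exists_eq_of_forall_normSq_charEval_eq_one fun ψ => ?_
  have hω := Complex.isPrimitiveRoot_exp e he
  set ω := Complex.exp (2 * Real.pi * Complex.I / e) with hωdef
  have hre : ω.re = Real.cos (2 * Real.pi / e) := by
    rw [← Complex.exp_ofReal_mul_I_re, hωdef]
    congr 2
    push_cast
    ring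
  have hψ : ∀ a, ψ a ∈ Algebra.adjoin ℤ {ω} := by
    intro a
    have hroot : ψ a ^ e = 1 := by
      rw [← AddChar.map_nsmul_eq_pow, ← AddChar.map_zero_eq_one ψ]
      exact congrArg ψ (hG a.toMul)
    have : NeZero e := ⟨he⟩
    obtain ⟨i, -, hi⟩ := hω.eq_pow_of_pow_eq_one hroot
    rw [← hi]
    exact pow_mem (Algebra.self_mem_adjoin_singleton ℤ ω) i
  have hnat : ∀ x, ∃ m : ℕ, Complex.normSq (charEval ψ x) = m := fun x =>
    exists_nat_normSq_eq_of_mem_adjoin (hω.norm'_eq_one he) (by rw [hre, ht]) (charEval_mem _ hψ x)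
  obtain ⟨m, hm⟩ := hnat u
  obtain ⟨k, hk⟩ := hnat (u⁻¹ : (IntGroupRing G)ˣ)
  have hmk : m * k = 1 := by
    apply Nat.cast_injective (R := ℝ)
    rw [Nat.cast_mul, Nat.cast_one, ← hm, ← hk, ← map_mul, ← map_mul, Units.mul_inv, map_one,
      map_one]
  rw [hm, Nat.eq_one_of_mul_eq_one_right hmk, Nat.cast_one]

theorem hasTrivialUnits_of_exponent_dvd
    (h : Monoid.exponent G ∣ 4 ∨ Monoid.exponent G ∣ 6) : HasTrivialUnits G := by
  simp only [Monoid.exponent_dvd_iff_forall_pow_eq_one] at h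
  refine .of_forall_fg fun K hK => ?_
  have : Group.FG K := (Group.fg_iff_subgroup_fg K).2 hK
  have hfinite : ∀ {e : ℕ}, e ≠ 0 → (∀ g : G, g ^ e = 1) → Finite K := fun he hG =>
    CommGroup.finite_of_fg_isMulTorsion K fun k =>
      isOfFinOrder_iff_pow_eq_one.2 ⟨_, he.bot_lt, Subtype.ext (hG k)⟩
  rcases h with h | h
  · have := hfinite (by norm_num) h
    refine hasTrivialUnits_of_two_mul_cos_eq_int (e := 4) (t := 0) (by norm_num) ?_
      fun k => Subtype.ext (h k)
    rw [show 2 * Real.pi / (4 : ℕ) = Real.pi / 2 by push_cast; ring]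
    simp
  · have := hfinite (by norm_num) h
    refine hasTrivialUnits_of_two_mul_cos_eq_int (e := 6) (t := 1) (by norm_num) ?_
      fun k => Subtype.ext (h k)
    rw [show 2 * Real.pi / (6 : ℕ) = Real.pi / 3 by push_cast; ring]
    simp

end AbelianGroups

section ElementaryAbelian

variable {G : Type*} [Group G]

/-- The two maps `ℤ[G × C₂] → ℤG` which extend the projection to `G` by sending the generator of
`C₂`, written as `ZMod 2`, to `ε = ± 1`. -/
noncomputable def evalCyclicTwo (ε : ℤˣ) :
    IntGroupRing (G × Multiplicative (ZMod 2)) →ₐ[ℤ] IntGroupRing G :=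
  MonoidAlgebra.lift ℤ _ _
    { toFun := fun p => single p.1 ((ε ^ p.2.toAdd.val : ℤˣ) : ℤ)
      map_one' := by simp [one_def]
      map_mul' := fun p q => by
        rw [single_mul_single, ← Units.val_mul, ← pow_add, Prod.fst_mul, Prod.snd_mul, toAdd_mul,
          ZMod.val_add, ← pow_eq_pow_mod _ (Int.units_sq ε)] }

theorem evalCyclicTwo_single (ε : ℤˣ) (p : G × Multiplicative (ZMod 2)) (r : ℤ) :
    evalCyclicTwo ε (single p r) = single p.1 (r * (ε ^ p.2.toAdd.val : ℤˣ)) := by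
  simp [evalCyclicTwo]

theorem eq_ofAdd_zero_or_eq_ofAdd_one :
    ∀ t : Multiplicative (ZMod 2), t = .ofAdd 0 ∨ t = .ofAdd 1 := by
  decide

theorem coeff_evalCyclicTwo (ε : ℤˣ) (x : IntGroupRing (G × Multiplicative (ZMod 2))) (g : G) :
    (evalCyclicTwo ε x).coeff g = x.coeff (g, .ofAdd 0) + ε * x.coeff (g, .ofAdd 1) := by
  classical
  induction x using MonoidAlgebra.induction_linear with
  | zero => simp
  | add x y hx hy =>
    simp only [map_add, coeff_add, Finsupp.add_apply, hx, hy]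
    ring
  | single p r =>
    obtain ⟨k, t⟩ := p
    have hval : (1 : ZMod 2).val = 1 := rfl
    by_cases hk : k = g <;> rcases eq_ofAdd_zero_or_eq_ofAdd_one t with rfl | rfl <;>
      simp [evalCyclicTwo_single, hval, hk, mul_comm]

theorem eq_of_evalCyclicTwo_eq {x y : IntGroupRing (G × Multiplicative (ZMod 2))}
    (h : ∀ ε, evalCyclicTwo ε x = evalCyclicTwo ε y) : x = y := by
  ext ⟨g, t⟩
  have h1 := congrArg (coeff · g) (h 1)
  have h2 := congrArg (coeff · g) (h (-1))
  simp only [coeff_evalCyclicTwo, Units.val_one, Units.val_neg, one_mul, neg_one_mul] at h1 h2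
  rcases eq_ofAdd_zero_or_eq_ofAdd_one t with rfl | rfl <;> omega

theorem HasTrivialUnits.prod_zmod_two (h : HasTrivialUnits G) :
    HasTrivialUnits (G × Multiplicative (ZMod 2)) := by
  intro u
  have hsingle : ∀ ε : ℤˣ, ∃ (g : G) (s : ℤˣ), evalCyclicTwo ε u.val = single g (s : ℤ) := by
    intro ε
    obtain ⟨g, hg | hg⟩ := h (Units.map (evalCyclicTwo ε).toRingHom.toMonoidHom u)
    · exact ⟨g, 1, hg⟩
    · exact ⟨g, -1, hg.trans (single_neg _ _).symm⟩
  obtain ⟨g, s, hs⟩ := hsingle 1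
  obtain ⟨k, r, hr⟩ := hsingle (-1)
  -- The two images of `u` agree modulo 2, hence have the same support.
  obtain rfl : g = k := by
    by_contra hne
    have h1 := congrArg (coeff · g) hs
    have h2 := congrArg (coeff · g) hr
    simp only [coeff_evalCyclicTwo, coeff_single, Finsupp.single_eq_same,
      Finsupp.single_eq_of_ne hne, Units.val_one, Units.val_neg] at h1 h2
    have := Int.isUnit_iff.1 s.isUnit
    omega
  obtain ⟨t, ht⟩ : ∃ t : Multiplicative (ZMod 2), (-1) ^ t.toAdd.val = r * s := by
    rcases Int.units_eq_one_or (r * s) with h | h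
    · exact ⟨.ofAdd 0, by simp [h]⟩
    · exact ⟨.ofAdd 1, by simp [h, ZMod.val_one]⟩
  have hu : u.val = single (g, t) (s : ℤ) := by
    apply eq_of_evalCyclicTwo_eq
    intro ε
    rcases Int.units_eq_one_or ε with rfl | rfl <;> rw [evalCyclicTwo_single]
    · rw [hs, one_pow, Units.val_one, mul_one]
    · rw [hr, ht, ← Units.val_mul, mul_left_comm, Int.units_mul_self, mul_one]
  refine ⟨(g, t), (Int.units_eq_one_or s).imp ?_ ?_⟩ <;> rintro rfl <;> rw [hu]
  · rfl
  · exact single_neg _ _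

theorem HasTrivialUnits.prod_pi_zmod_two (h : HasTrivialUnits G) (n : ℕ) :
    HasTrivialUnits (G × Multiplicative (Fin n → ZMod 2)) := by
  induction n generalizing G with
  | zero => exact h.of_injective (f := MonoidHom.fst _ _) fun p q hpq =>
      Prod.ext hpq (Subsingleton.elim (α := Fin 0 → ZMod 2) _ _)
  | succ n ih =>
    let f : G × Multiplicative (Fin (n + 1) → ZMod 2) →*
        (G × Multiplicative (ZMod 2)) × Multiplicative (Fin n → ZMod 2) :=
      { toFun := fun p => ((p.1, .ofAdd (p.2.toAdd 0)), .ofAdd (Fin.tail p.2.toAdd))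
        map_one' := rfl
        map_mul' := fun _ _ => rfl }
    refine (ih h.prod_zmod_two).of_injective (f := f) ?_
    rintro ⟨g, v⟩ ⟨k, w⟩ hvw
    obtain ⟨hhead, htail⟩ := Prod.ext_iff.1 hvw
    obtain ⟨hg, hzero⟩ := Prod.ext_iff.1 hhead
    refine Prod.ext hg ?_
    change v.toAdd = w.toAdd
    rw [← Fin.cons_self_tail v.toAdd, ← Fin.cons_self_tail w.toAdd]
    exact congrArg₂ (Fin.cons (α := fun _ => ZMod 2)) hzero htail

theorem exists_injective_monoidHom_pi_zmod_two {E : Type*} [CommGroup E] [Finite E]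
    (hE : ∀ e : E, e ^ 2 = 1) :
    ∃ (n : ℕ) (f : E →* Multiplicative (Fin n → ZMod 2)), Function.Injective f := by
  let _ : Module (ZMod 2) (Additive E) :=
    AddCommGroup.zmodModule fun e => congrArg Additive.ofMul (hE e.toMul)
  let b := Module.finBasis (ZMod 2) (Additive E)
  exact ⟨_, AddMonoidHom.toMultiplicativeRight b.equivFun.toAddMonoidHom, b.equivFun.injective⟩

theorem HasTrivialUnits.prod {E : Type*} [CommGroup E] (h : HasTrivialUnits G)
    (hE : ∀ e : E, e ^ 2 = 1) : HasTrivialUnits (G × E) := by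
  refine .of_forall_fg fun K hK => ?_
  let F := K.map (MonoidHom.snd G E)
  have hF : ∀ e : F, e ^ 2 = 1 := fun e => Subtype.ext (hE e)
  have : Group.FG K := (Group.fg_iff_subgroup_fg K).2 hK
  have : Group.FG F := Group.fg_of_surjective ((MonoidHom.snd G E).subgroupMap_surjective K)
  have : Finite F := CommGroup.finite_of_fg_isMulTorsion F fun e =>
    isOfFinOrder_iff_pow_eq_one.2 ⟨2, two_pos, hF e⟩
  obtain ⟨n, f, hf⟩ := exists_injective_monoidHom_pi_zmod_two hF
  let ι : K →* G × F :=
    ((MonoidHom.fst G E).comp K.subtype).prod ((MonoidHom.snd G E).subgroupMap K)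
  refine (h.prod_pi_zmod_two n).of_injective (f := (MonoidHom.prodMap (.id G) f).comp ι) ?_
  refine (Function.injective_id.prodMap hf).comp fun p q hpq => ?_
  obtain ⟨hfst, hsnd⟩ := Prod.ext_iff.1 hpq
  exact Subtype.ext (Prod.ext hfst (congrArg Subtype.val hsnd))

end ElementaryAbelian

section Quaternion

open scoped Quaternion

section Lift

variable {M : Type*} [Monoid M] {A X : M}

theorem pow_val_natCast {m : ℕ} (hA : A ^ m = 1) (k : ℕ) : A ^ (k : ZMod m).val = A ^ k := by
  rw [ZMod.val_natCast]
  exact (pow_eq_pow_mod k hA).symm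

theorem pow_val_add {m : ℕ} [NeZero m] (hA : A ^ m = 1) (i j : ZMod m) :
    A ^ (i + j).val = A ^ i.val * A ^ j.val := by
  rw [ZMod.val_add, ← pow_add]
  exact (pow_eq_pow_mod _ hA).symm

theorem pow_mul_mul_pow_of_mul_mul_eq (h : A * X * A = X) (k : ℕ) : A ^ k * X * A ^ k = X := by
  induction k with
  | zero => simp
  | succ k ih =>
    calc A ^ (k + 1) * X * A ^ (k + 1) = A ^ k * A * X * (A * A ^ k) := by
          rw [← pow_succ, ← pow_succ']
      _ = A ^ k * (A * X * A) * A ^ k := by simp only [mul_assoc]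
      _ = X := by rw [h, ih]

/-- The homomorphism out of the generalized quaternion group
`⟨a, x | a ^ (2 * n) = 1, x * x = a ^ n, a * x * a = x⟩` which maps `a` to `A` and `x` to `X`. -/
def quaternionLift {n : ℕ} [NeZero n] (A X : M) (hA : A ^ (2 * n) = 1) (hX : X * X = A ^ n)
    (hAX : A * X * A = X) : QuaternionGroup n →* M where
  toFun
    | .a i => A ^ i.val
    | .xa i => X * A ^ i.val
  map_one' := by
    rw [QuaternionGroup.one_def]
    simp
  map_mul' := by
    have hconj : ∀ i j : ZMod (2 * n), A ^ i.val * X * A ^ j.val = X * A ^ (j - i).val := by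
      intro i j
      rw [← add_sub_cancel i j, pow_val_add hA, ← mul_assoc,
        pow_mul_mul_pow_of_mul_mul_eq hAX, add_sub_cancel]
    rintro (i | i) (j | j)
    · exact pow_val_add hA i j
    · simp only [QuaternionGroup.a_mul_xa, ← hconj, mul_assoc]
    · simp only [QuaternionGroup.xa_mul_a, pow_val_add hA, mul_assoc]
    · simp only [QuaternionGroup.xa_mul_xa, add_sub_assoc, pow_val_add hA, pow_val_natCast hA,
        ← hX, mul_assoc, ← hconj]

end Lift

/-- The four linear characters of the quaternion group of order 8, extended to the group ring. -/
noncomputable def quaternionCharacter (ε δ : ℤˣ) : IntGroupRing (QuaternionGroup 2) →ₐ[ℤ] ℤ :=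
  MonoidAlgebra.lift ℤ ℤ _
    (quaternionLift (ε : ℤ) δ (by norm_cast; exact pow_mul ε 2 2 ▸ by simp) (by norm_cast; simp)
      (by norm_cast; simp [mul_right_comm]))

/-- The embedding of the quaternion group of order 8 into Hamilton's quaternions which maps `a 1`
to `i` and `xa 0` to `j`. -/
def quaternionEmbedding : QuaternionGroup 2 →* ℍ[ℤ] :=
  quaternionLift (⟨0, 1, 0, 0⟩ : ℍ[ℤ]) ⟨0, 0, 1, 0⟩ (by rfl) (by rfl) (by rfl)

/-- The linear extension of `quaternionEmbedding` to the group ring. -/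
noncomputable def quaternionRep : IntGroupRing (QuaternionGroup 2) →ₐ[ℤ] ℍ[ℤ] :=
  MonoidAlgebra.lift ℤ ℍ[ℤ] _ quaternionEmbedding

theorem quaternionGroup_sum_eq {A : Type*} [AddCommMonoid A] (f : QuaternionGroup 2 → A) :
    ∑ g, f g = f (.a 0) + f (.a 1) + f (.a 2) + f (.a 3) +
      (f (.xa 0) + f (.xa 1) + f (.xa 2) + f (.xa 3)) := by
  rw [show (Finset.univ : Finset (QuaternionGroup 2)) =
    {.a 0, .a 1, .a 2, .a 3, .xa 0, .xa 1, .xa 2, .xa 3} by decide]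
  repeat rw [Finset.sum_insert (by decide)]
  rw [Finset.sum_singleton]
  simp only [add_assoc]

theorem quaternionCharacter_apply (ε δ : ℤˣ) (x : IntGroupRing (QuaternionGroup 2)) :
    quaternionCharacter ε δ x = x.coeff (.a 0) + x.coeff (.a 2) +
      ε * (x.coeff (.a 1) + x.coeff (.a 3)) + δ * (x.coeff (.xa 0) + x.coeff (.xa 2)) +
      ε * δ * (x.coeff (.xa 1) + x.coeff (.xa 3)) := by
  have h0 : (0 : ZMod (2 * 2)).val = 0 := rfl
  have h1 : (1 : ZMod (2 * 2)).val = 1 := rfl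
  have h2 : (2 : ZMod (2 * 2)).val = 2 := rfl
  have h3 : (3 : ZMod (2 * 2)).val = 3 := rfl
  have hsq : (ε : ℤ) ^ 2 = 1 := by norm_cast; simp
  have hcube : (ε : ℤ) ^ 3 = ε := by rw [pow_succ, hsq, one_mul]
  rw [quaternionCharacter, lift_apply_eq_sum, quaternionGroup_sum_eq]
  simp only [quaternionLift, MonoidHom.coe_mk, OneHom.coe_mk, h0, h1, h2, h3, hsq, hcube,
    Int.cast_id]
  ring

theorem normSq_quaternionRep (x : IntGroupRing (QuaternionGroup 2)) :
    Quaternion.normSq (quaternionRep x) =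
      (x.coeff (.a 0) - x.coeff (.a 2)) ^ 2 + (x.coeff (.a 1) - x.coeff (.a 3)) ^ 2 +
      ((x.coeff (.xa 0) - x.coeff (.xa 2)) ^ 2 + (x.coeff (.xa 1) - x.coeff (.xa 3)) ^ 2) := by
  let q : QuaternionGroup 2 → ℍ[ℤ] := quaternionEmbedding
  have h0 : (q (.a 0)).re = 1 ∧ (q (.a 0)).imI = 0 ∧ (q (.a 0)).imJ = 0 ∧ (q (.a 0)).imK = 0 := by
    decide
  have h1 : (q (.a 1)).re = 0 ∧ (q (.a 1)).imI = 1 ∧ (q (.a 1)).imJ = 0 ∧ (q (.a 1)).imK = 0 := by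
    decide
  have h2 : (q (.xa 0)).re = 0 ∧ (q (.xa 0)).imI = 0 ∧ (q (.xa 0)).imJ = 1 ∧
      (q (.xa 0)).imK = 0 := by
    decide
  have h3 : (q (.xa 1)).re = 0 ∧ (q (.xa 1)).imI = 0 ∧ (q (.xa 1)).imJ = 0 ∧
      (q (.xa 1)).imK = -1 := by
    decide
  have hneg : q (.a 2) = -q (.a 0) ∧ q (.a 3) = -q (.a 1) ∧ q (.xa 2) = -q (.xa 0) ∧
      q (.xa 3) = -q (.xa 1) := ⟨rfl, rfl, rfl, rfl⟩
  have hx : quaternionRep x = ∑ g, (x.coeff g : ℍ[ℤ]) * q g := lift_apply_eq_sum _ x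
  rw [Quaternion.normSq_def', hx, quaternionGroup_sum_eq]
  clear_value q
  simp only [hneg, h0, h1, h2, h3, Int.cast_eq, Quaternion.re_add, Quaternion.imI_add,
    Quaternion.imJ_add, Quaternion.imK_add, Quaternion.re_mul, Quaternion.imI_mul,
    Quaternion.imJ_mul, Quaternion.imK_mul, Quaternion.re_neg, Quaternion.imI_neg,
    Quaternion.imJ_neg, Quaternion.imK_neg, Quaternion.re_intCast, Quaternion.imI_intCast,
    Quaternion.imJ_intCast, Quaternion.imK_intCast]
  ring

/-- Parseval's identity for the quaternion group of order 8. -/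
theorem sum_sq_coeff_eq_quaternion (x : IntGroupRing (QuaternionGroup 2)) :
    8 * ∑ g, x.coeff g ^ 2 = ∑ ε, ∑ δ, quaternionCharacter ε δ x ^ 2 +
      4 * Quaternion.normSq (quaternionRep x) := by
  have hunits : (Finset.univ : Finset ℤˣ) = {1, -1} := rfl
  have hne : (1 : ℤˣ) ≠ -1 := by decide
  simp only [quaternionGroup_sum_eq, quaternionCharacter_apply, normSq_quaternionRep, hunits,
    Finset.sum_pair hne, Units.val_one, Units.val_neg]
  ring

theorem hasTrivialUnits_quaternionGroup : HasTrivialUnits (QuaternionGroup 2) := by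
  intro u
  have hchar : ∀ ε δ, quaternionCharacter ε δ u.val ^ 2 = 1 := fun ε δ =>
    sq_eq_one_iff.2 (Int.isUnit_iff.1 (u.isUnit.map _))
  have hrep : Quaternion.normSq (quaternionRep u.val) = 1 :=
    (Int.isUnit_iff.1 ((u.isUnit.map quaternionRep).map Quaternion.normSq)).resolve_right
      (by linarith [Quaternion.normSq_nonneg (a := quaternionRep u.val)])
  have h := sum_sq_coeff_eq_quaternion u.val
  simp only [hchar, hrep, Finset.sum_const, Finset.card_univ, Fintype.card_units_int] at h
  exact exists_eq_of_sum_sq_coeff_eq_one (by norm_num at h; omega)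

end Quaternion

section DimensionSubgroups

variable {G : Type*} [Group G]

section PolynomialMaps

variable {A : Type*} [AddCommGroup A]

/-- The additive extension to `ℤG` of a map from `G` to an abelian group. -/
noncomputable def linearExtension (f : G → A) : IntGroupRing G →+ A :=
  (Finsupp.liftAddHom fun g => (zmultiplesHom A) (f g)).comp coeffAddEquiv.toAddMonoidHom

theorem linearExtension_single (f : G → A) (g : G) (r : ℤ) :
    linearExtension f (single g r) = r • f g := by
  simp [linearExtension]

theorem linearExtension_of_sub_one (f : G → A) (g : G) :
    linearExtension f (of ℤ G g - 1) = f g - f 1 := by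
  rw [map_sub, of_apply, one_def, linearExtension_single, linearExtension_single, one_smul,
    one_smul]

theorem linearExtension_mul_of_sub_one (f : G → A) (x : IntGroupRing G) (h : G) :
    linearExtension f (x * (of ℤ G h - 1)) = linearExtension (fun g => f (g * h) - f g) x := by
  induction x using MonoidAlgebra.induction_linear with
  | zero => simp
  | add x y hx hy => rw [add_mul, map_add, hx, hy, map_add]
  | single g r =>
    rw [mul_sub, mul_one, of_apply, single_mul_single, mul_one, map_sub]
    simp only [linearExtension_single, smul_sub]

/-- Polynomial maps of degree less than `n` from a group to an abelian group: those which are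
annihilated by `n` successive difference operators `f ↦ (g ↦ f (g * h) - f g)`. -/
def IsPolynomialOfDegreeLT : ℕ → (G → A) → Prop
  | 0, f => f = 0
  | n + 1, f => ∀ h, IsPolynomialOfDegreeLT n fun g => f (g * h) - f g

theorem isPolynomialOfDegreeLT_two {f : G → A} (hf : ∀ g h, f (g * h) = f g + f h - f 1) :
    IsPolynomialOfDegreeLT 2 f := by
  intro h k
  ext1 g
  simp only [hf, Pi.zero_apply]
  abel

theorem IsPolynomialOfDegreeLT.linearExtension_eq_zero {n : ℕ} {f : G → A}
    (hf : IsPolynomialOfDegreeLT n f) {x : IntGroupRing G} (hx : x ∈ augIdeal G ^ n) :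
    linearExtension f x = 0 := by
  induction n generalizing f x with
  | zero =>
    obtain rfl : f = 0 := hf
    clear hx
    induction x using MonoidAlgebra.induction_linear with
    | zero => simp
    | add x y hx hy => rw [map_add, hx, hy, add_zero]
    | single g r => rw [linearExtension_single, Pi.zero_apply, smul_zero]
  | succ n ih =>
    have hspan : ∀ b ∈ augIdeal G, ∀ a ∈ augIdeal G ^ n, linearExtension f (a * b) = 0 := by
      intro b hb
      rw [augIdeal_eq_span] at hb
      induction hb using Submodule.span_induction with
      | mem b hb =>
        obtain ⟨h, rfl⟩ := hb
        intro a ha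
        rw [linearExtension_mul_of_sub_one, ih (hf h) ha]
      | zero => simp
      | add b c _ _ hb hc => intro a ha; rw [mul_add, map_add, hb a ha, hc a ha, add_zero]
      | smul c b _ hb =>
        intro a ha
        rw [smul_eq_mul, ← mul_assoc]
        exact hb _ (Ideal.mul_mem_right _ _ ha)
    rw [Submodule.pow_succ] at hx
    induction hx using Submodule.mul_induction_on' with
    | mem_mul_mem a ha b hb => exact hspan b hb a ha
    | add a _ b _ ha hb => rw [map_add, ha, hb, add_zero]

theorem IsPolynomialOfDegreeLT.apply_eq_apply_one {n : ℕ} {f : G → A}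
    (hf : IsPolynomialOfDegreeLT n f) {g : G} (hg : of ℤ G g - 1 ∈ augIdeal G ^ n) :
    f g = f 1 := by
  rw [← sub_eq_zero, ← linearExtension_of_sub_one, hf.linearExtension_eq_zero hg]

end PolynomialMaps

theorem eq_one_of_sub_one_mem_augIdeal_sq {G : Type*} [CommGroup G] {g : G}
    (hg : of ℤ G g - 1 ∈ augIdeal G ^ 2) : g = 1 := by
  have hf : IsPolynomialOfDegreeLT 2 (Additive.ofMul : G → Additive G) :=
    isPolynomialOfDegreeLT_two fun g h => by simp
  exact Additive.ofMul.injective (hf.apply_eq_apply_one hg)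

/-- The exponents in the normal form `x ^ j * a ^ (i₀ + 2 * i₁)` of an element of the quaternion
group of order 8, where each of `i₀`, `j`, `i₁` is `0` or `1`. -/
def quaternionCoordinates : QuaternionGroup 2 → ZMod 2 × ZMod 2 × ZMod 2
  | .a i => (i.val, 0, (i.val / 2 : ℕ))
  | .xa i => (i.val, 1, (i.val / 2 : ℕ))

theorem quaternionCoordinates_injective : Function.Injective quaternionCoordinates := by
  decide

theorem isPolynomialOfDegreeLT_quaternionCoordinates :
    IsPolynomialOfDegreeLT 3 quaternionCoordinates := by
  intro h
  apply isPolynomialOfDegreeLT_two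
  revert h
  decide +kernel

theorem eq_one_of_sub_one_mem_augIdeal_cube {g : QuaternionGroup 2}
    (hg : of ℤ _ g - 1 ∈ augIdeal (QuaternionGroup 2) ^ 3) : g = 1 :=
  quaternionCoordinates_injective
    (isPolynomialOfDegreeLT_quaternionCoordinates.apply_eq_apply_one hg)

theorem HasTrivialUnits.unitFiltration_eq_bot (h : HasTrivialUnits G) {n : ℕ}
    (hn : ∀ g : G, of ℤ G g - 1 ∈ augIdeal G ^ n → g = 1) : unitFiltration G n = ⊥ := by
  refine (Subgroup.eq_bot_iff_forall _).2 fun u hu => ?_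
  obtain ⟨hu1, hun⟩ := mem_unitFiltration.1 hu
  rw [mem_normalizedUnits] at hu1
  obtain ⟨g, hg | hg⟩ := h u
  · rw [hg] at hun
    rw [Units.ext_iff, hg, hn g hun, map_one, Units.val_one]
  · rw [hg, map_neg, augmentation_of] at hu1
    norm_num at hu1

theorem of_map_sub_one_mem_augIdeal_pow {H : Type*} [Group H] (f : G →* H) {g : G} {n : ℕ}
    (hg : of ℤ G g - 1 ∈ augIdeal G ^ n) : of ℤ H (f g) - 1 ∈ augIdeal H ^ n := by
  have h := mapDomainRingHom_mem_augIdeal_pow f hg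
  rwa [map_sub, map_one, show mapDomainRingHom ℤ f (of ℤ G g) = of ℤ H (f g) by simp] at h

theorem unitFiltration_two_eq_bot {G : Type*} [CommGroup G] (h : HasTrivialUnits G) :
    unitFiltration G 2 = ⊥ :=
  h.unitFiltration_eq_bot fun _ => eq_one_of_sub_one_mem_augIdeal_sq

theorem unitFiltration_quaternionGroup_prod_three_eq_bot {E : Type*} [CommGroup E]
    (hE : ∀ e : E, e ^ 2 = 1) : unitFiltration (QuaternionGroup 2 × E) 3 = ⊥ := by
  refine (hasTrivialUnits_quaternionGroup.prod hE).unitFiltration_eq_bot fun g hg => ?_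
  have hfst : g.1 = 1 := eq_one_of_sub_one_mem_augIdeal_cube
    (of_map_sub_one_mem_augIdeal_pow (MonoidHom.fst (QuaternionGroup 2) E) hg)
  have hsnd : g.2 = 1 := eq_one_of_sub_one_mem_augIdeal_sq (Ideal.pow_le_pow_right (by norm_num)
    (of_map_sub_one_mem_augIdeal_pow (MonoidHom.snd (QuaternionGroup 2) E) hg))
  exact Prod.ext hfst hsnd

end DimensionSubgroups

section CyclicSubgroups

variable {G : Type*} [Group G]

theorem eq_zero_of_mul_self_eq_zero_of_unitFiltration_eq_bot {n m : ℕ}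
    (h : unitFiltration G n = ⊥) (hm : m ≠ 0) {x : IntGroupRing G} (hx : x * x = 0)
    (hmem : m • x ∈ augIdeal G ^ n) : x = 0 := by
  have hsq : m • x * m • x = 0 := by rw [smul_mul_smul_comm, hx, smul_zero]
  let u : (IntGroupRing G)ˣ := ⟨1 + m • x, 1 - m • x,
    by rw [mul_sub, mul_one, add_mul, hsq]; simp, by rw [sub_mul, one_mul, mul_add, hsq]; simp⟩
  have haug : augmentation G x = 0 := by
    rw [← mul_self_eq_zero, ← map_mul, hx, map_zero]
  have hu : u ∈ unitFiltration G n := by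
    refine mem_unitFiltration.2 ⟨?_, by simpa [u] using hmem⟩
    rw [mem_normalizedUnits]
    simp [u, haug]
  rw [h, Subgroup.mem_bot] at hu
  have hzero : m • x = 0 := add_eq_left.1 (congrArg Units.val hu)
  ext a
  have hcoeff := congrArg (fun y => y.coeff a) hzero
  rw [coeff_smul_apply] at hcoeff
  exact (smul_eq_zero.1 hcoeff).resolve_left hm

theorem exists_mul_eq_mul_pow_of_mul_sum_eq_zero {g h : G} {n : ℕ} (hn : n ≠ 0)
    (hzero : (of ℤ G g - 1) * (of ℤ G h * ∑ i ∈ Finset.range n, of ℤ G (g ^ i)) = 0) :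
    ∃ i : ℕ, g * h = h * g ^ i := by
  classical
  have hsum : ∑ i ∈ Finset.range n, of ℤ G (g * h * g ^ i) =
      ∑ i ∈ Finset.range n, of ℤ G (h * g ^ i) := by
    rw [sub_mul, one_mul, sub_eq_zero, ← mul_assoc, Finset.mul_sum, Finset.mul_sum] at hzero
    simpa only [map_mul] using hzero
  have hcoeff := congrArg (fun y => y.coeff (g * h)) hsum
  simp only [coeff_sum, Finsupp.finsetSum_apply, of_apply, coeff_single,
    Finsupp.single_apply] at hcoeff
  have hpos : 0 < ∑ i ∈ Finset.range n, if g * h * g ^ i = g * h then (1 : ℤ) else 0 :=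
    Finset.sum_pos' (fun i _ => by split_ifs <;> norm_num)
      ⟨0, Finset.mem_range.2 (Nat.pos_of_ne_zero hn), by simp⟩
  obtain ⟨i, -, hi⟩ := Finset.exists_ne_zero_of_sum_ne_zero (hcoeff ▸ hpos.ne')
  exact ⟨i, (by_contra fun hne => hi (if_neg hne) : h * g ^ i = g * h).symm⟩

theorem exists_mul_eq_mul_pow_of_unitFiltration_eq_bot {n : ℕ} (hbot : unitFiltration G n = ⊥)
    {g : G} (hg : IsOfFinOrder g) (h : G) : ∃ i : ℕ, g * h = h * g ^ i := by
  set N : IntGroupRing G := ∑ i ∈ Finset.range (orderOf g), of ℤ G (g ^ i) with hN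
  have hNg : N * (of ℤ G g - 1) = 0 := by
    simp only [hN, map_pow]
    rw [geom_sum_mul, ← map_pow, pow_orderOf_eq_one, map_one, sub_self]
  -- `1 + m • (g - 1) * h * N` are the powers of a bicyclic unit.
  have hsq : (of ℤ G g - 1) * (of ℤ G h * N) * ((of ℤ G g - 1) * (of ℤ G h * N)) = 0 := by
    calc _ = (of ℤ G g - 1) * of ℤ G h * (N * (of ℤ G g - 1)) * (of ℤ G h * N) := by
          simp only [mul_assoc]
      _ = 0 := by rw [hNg, mul_zero, zero_mul]
  have hmem : orderOf g ^ n • ((of ℤ G g - 1) * (of ℤ G h * N)) ∈ augIdeal G ^ n := by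
    rw [← smul_mul_assoc]
    exact Ideal.mul_mem_right _ _ (Ideal.pow_le_pow_right n.le_succ
      (pow_nsmul_of_sub_one_mem_augIdeal_pow (pow_orderOf_eq_one g) n))
  exact exists_mul_eq_mul_pow_of_mul_sum_eq_zero hg.orderOf_pos.ne'
    (eq_zero_of_mul_self_eq_zero_of_unitFiltration_eq_bot hbot
      (pow_ne_zero n hg.orderOf_pos.ne') hsq hmem)

theorem eq_one_or_add_one_eq_of_coprime {n i : ℕ} (hn : n ∣ 4 ∨ n ∣ 6) (hi : i < n)
    (hcop : n.Coprime i) : i = 1 ∨ i + 1 = n := by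
  have hle : n ≤ 6 := by
    rcases hn with h | h <;> linarith [Nat.le_of_dvd (by norm_num) h]
  interval_cases n <;> interval_cases i <;> revert hn hcop <;> decide

theorem pow_eq_self_or_inv_of_semiconjBy {x y : G} {i : ℕ} (hord : orderOf x ∣ 4 ∨ orderOf x ∣ 6)
    (h : SemiconjBy y (x ^ i) x) : x ^ i = x ∨ x ^ i = x⁻¹ := by
  have hpos : 0 < orderOf x := Nat.pos_of_ne_zero fun h0 => by simp [h0] at hord
  have hcop : (orderOf x).Coprime i := by
    have hdiv := (IsOfFinOrder.orderOf_pow x i (orderOf_pos_iff.1 hpos)).symm.trans (h.orderOf_eq y)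
    exact (Nat.div_eq_self.1 hdiv).resolve_left hpos.ne'
  have hcop' : (orderOf x).Coprime (i % orderOf x) :=
    ((ZMod.coprime_mod_iff_coprime i _).2 hcop.symm).symm
  rw [← pow_mod_orderOf]
  rcases eq_one_or_add_one_eq_of_coprime hord (Nat.mod_lt i hpos) hcop' with h1 | h1
  · exact .inl (by rw [h1, pow_one])
  · exact .inr (eq_inv_of_mul_eq_one_left (by rw [← pow_succ, h1, pow_orderOf_eq_one]))

end CyclicSubgroups

section StructureTheorem

variable {G : Type*} [Group G]

/-- Groups in which every conjugate of an element is that element or its inverse. The equation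
`x * y * x = y` says that conjugation by `y` inverts `x`. -/
def CommutesOrInverts (G : Type*) [Group G] : Prop :=
  ∀ x y : G, Commute x y ∨ x * y * x = y

theorem commutesOrInverts_of_unitFiltration_eq_bot {n : ℕ} (h : unitFiltration G n = ⊥)
    (hG : IsMulTorsion G) : CommutesOrInverts G := by
  intro x y
  have hord := orderOf_dvd_four_or_six_of_unitFiltration_eq_bot h (hG x)
  obtain ⟨i, hi⟩ := exists_mul_eq_mul_pow_of_unitFiltration_eq_bot h (hG x) y
  rcases pow_eq_self_or_inv_of_semiconjBy hord hi.symm with hxi | hxi <;> rw [hxi] at hi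
  · exact .inl hi
  · exact .inr (by rw [hi, inv_mul_cancel_right])

section Relations

variable {x y : G}

theorem mul_self_eq_mul_self_of_mul_mul_eq (hx : x * y * x = y) (hy : y * x * y = x) :
    y * y = x * x :=
  calc y * y = x * y * x * y := by rw [hx]
    _ = x * (y * x * y) := by simp only [mul_assoc]
    _ = x * x := by rw [hy]

theorem pow_four_eq_one_of_mul_mul_eq (hx : x * y * x = y) (hy : y * x * y = x) : x ^ 4 = 1 := by
  have hsq : x ^ 2 = y * y := by rw [mul_self_eq_mul_self_of_mul_mul_eq hx hy, sq]
  have hcomm : Commute (x ^ 2) y := hsq ▸ (Commute.refl y).mul_left (.refl y)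
  have h : x ^ 2 * y * x ^ 2 = y := pow_mul_mul_pow_of_mul_mul_eq hx 2
  rwa [mul_assoc, ← hcomm.eq, ← mul_assoc, ← pow_add, mul_eq_right] at h

theorem commute_mul_inv_of_mul_mul_eq {g : G} (hg : x * g * x = g) (hy : x * y * x = y) :
    Commute x (g * y⁻¹) :=
  calc x * (g * y⁻¹) = x * g * x * (x⁻¹ * y⁻¹) := by group
    _ = g * y⁻¹ * (x * y * x) * x⁻¹ * y⁻¹ := by rw [hg, hy]; group
    _ = g * y⁻¹ * x := by group

end Relations

namespace CommutesOrInverts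

theorem mul_mul_eq (h : CommutesOrInverts G) {x y : G} (hxy : ¬ Commute x y) : x * y * x = y :=
  (h x y).resolve_left hxy

theorem mul_self_eq (h : CommutesOrInverts G) {x y : G} (hxy : ¬ Commute x y) : y * y = x * x :=
  mul_self_eq_mul_self_of_mul_mul_eq (h.mul_mul_eq hxy) (h.mul_mul_eq (mt .symm hxy))

theorem mul_self_ne_one (h : CommutesOrInverts G) {x y : G} (hxy : ¬ Commute x y) :
    x * x ≠ 1 := by
  intro hx
  have hmul := h.mul_mul_eq hxy
  rw [mul_eq_one_iff_eq_inv] at hx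
  exact hxy (mul_inv_eq_iff_eq_mul.1 (hx ▸ hmul))

theorem mul_self_eq_one_of_commute (h : CommutesOrInverts G) {x y c : G} (hxy : ¬ Commute x y)
    (hcx : Commute c x) (hcy : Commute c y) : c * c = 1 := by
  have hcxy : ¬ Commute (c * x) y := fun hcxy =>
    hxy (by simpa using hcy.inv_left.mul_left hcxy)
  have heq : c * x * (c * x) = x * x := (h.mul_self_eq hcxy).symm.trans (h.mul_self_eq hxy)
  rwa [← hcx.mul_mul_mul_comm, mul_eq_right] at heq

variable (h : CommutesOrInverts G) {x y : G} (hxy : ¬ Commute x y)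

/-- The homomorphism from the quaternion group of order 8 onto the subgroup generated by two
noncommuting elements. -/
def quaternionHom : QuaternionGroup 2 →* G :=
  quaternionLift x y (pow_four_eq_one_of_mul_mul_eq (h.mul_mul_eq hxy)
    (h.mul_mul_eq (mt .symm hxy))) ((h.mul_self_eq hxy).trans (sq x).symm) (h.mul_mul_eq hxy)

theorem quaternionHom_a_one : h.quaternionHom hxy (.a 1) = x :=
  pow_one x

theorem quaternionHom_xa_zero : h.quaternionHom hxy (.xa 0) = y :=
  (congrArg (y * ·) (pow_zero x)).trans (mul_one y)

theorem quaternionHom_injective : Function.Injective (h.quaternionHom hxy) := by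
  have hmin : ∀ q : QuaternionGroup 2, q = 1 ∨ q = .a 1 * .a 1 ∨ q * q = .a 1 * .a 1 := by decide
  have hz : h.quaternionHom hxy (.a 1 * .a 1) ≠ 1 := by
    rw [map_mul, quaternionHom_a_one]
    exact h.mul_self_ne_one hxy
  refine (injective_iff_map_eq_one _).2 fun q hq => ?_
  rcases hmin q with rfl | rfl | hqq
  · rfl
  · exact absurd hq hz
  · rw [← hqq, map_mul, hq, mul_one] at hz
    exact absurd rfl hz

theorem mem_centralizer_range_quaternionHom_iff {c : G} :
    c ∈ Subgroup.centralizer (Set.range (h.quaternionHom hxy)) ↔ Commute c x ∧ Commute c y := by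
  rw [Subgroup.mem_centralizer_iff, Set.forall_mem_range]
  constructor
  · intro hc
    have hcx := hc (.a 1)
    have hcy := hc (.xa 0)
    rw [quaternionHom_a_one] at hcx
    rw [quaternionHom_xa_zero] at hcy
    exact ⟨hcx.symm, hcy.symm⟩
  · rintro ⟨hcx, hcy⟩ (i | i)
    · exact (hcx.pow_right i.val).symm
    · exact (hcy.mul_right (hcx.pow_right i.val)).symm

theorem exists_eq_mul_quaternionHom (g : G) :
    ∃ c ∈ Subgroup.centralizer (Set.range (h.quaternionHom hxy)), ∃ q,
      g = c * h.quaternionHom hxy q := by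
  have hx := h.mul_mul_eq hxy
  have hy := h.mul_mul_eq (mt .symm hxy)
  have hcomm : ∀ g, Commute x g → ∃ c ∈ Subgroup.centralizer (Set.range (h.quaternionHom hxy)),
      ∃ q, g = c * h.quaternionHom hxy q := by
    intro g hxg
    simp only [mem_centralizer_range_quaternionHom_iff]
    rcases h y g with hyg | hyg
    · exact ⟨g, ⟨hxg.symm, hyg.symm⟩, 1, by simp⟩
    · refine ⟨g * x⁻¹, ⟨(hxg.mul_right (Commute.refl x).inv_right).symm,
        (commute_mul_inv_of_mul_mul_eq hyg hy).symm⟩, .a 1, ?_⟩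
      rw [quaternionHom_a_one, inv_mul_cancel_right]
  rcases h x g with hxg | hxg
  · exact hcomm g hxg
  · obtain ⟨c, hc, q, hq⟩ := hcomm (g * y⁻¹) (commute_mul_inv_of_mul_mul_eq hxg hx)
    refine ⟨c, hc, q * .xa 0, ?_⟩
    rw [map_mul, quaternionHom_xa_zero, ← mul_assoc, ← hq, inv_mul_cancel_right]

end CommutesOrInverts

theorem exists_subgroup_notMem_and_forall_mem_or_mul_mem {C : Type*} [CommGroup C]
    (hC : ∀ c : C, c ^ 2 = 1) {z : C} (hz : z ≠ 1) :
    ∃ E : Subgroup C, z ∉ E ∧ ∀ c, c ∈ E ∨ z * c ∈ E := by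
  let : Module (ZMod 2) (Additive C) := AddCommGroup.zmodModule hC
  obtain ⟨f, hf⟩ := Module.Projective.exists_dual_ne_zero (V := Additive C) (ZMod 2) hz
  have htwo : ∀ a b : ZMod 2, a ≠ 0 → b = 0 ∨ a + b = 0 := by decide
  refine ⟨f.toAddMonoidHom.toMultiplicativeRight.ker, hf, fun c => ?_⟩
  exact (htwo _ (f (.ofMul c)) hf).imp_right (map_add f _ _).trans

theorem exists_mulEquiv_quaternionGroup_prod_of_injective {G : Type u} [Group G]
    {ρ : QuaternionGroup 2 →* G} (hρ : Function.Injective ρ)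
    (hC : ∀ c ∈ Subgroup.centralizer (Set.range ρ), c ^ 2 = 1)
    (hG : ∀ g, ∃ c ∈ Subgroup.centralizer (Set.range ρ), ∃ q, g = c * ρ q) :
    ∃ (E : Type u) (_ : CommGroup E), (∀ e : E, e ^ 2 = 1) ∧
      Nonempty (G ≃* QuaternionGroup 2 × E) := by
  set C := Subgroup.centralizer (Set.range ρ)
  have hcomm : ∀ q (c : C), Commute (ρ q) c := fun q c =>
    Subgroup.mem_centralizer_iff.1 c.2 _ ⟨q, rfl⟩
  have hC2 : ∀ c : C, c ^ 2 = 1 := fun c => Subtype.ext (hC c c.2)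
  let : CommGroup C :=
    { (inferInstance : Group C) with
      mul_comm := Commute.of_orderOf_dvd_two fun c => orderOf_dvd_of_pow_eq_one (hC2 c) }
  have hcenter : ∀ q : QuaternionGroup 2, (∀ r, r * q = q * r) ↔ q = 1 ∨ q = .a 2 := by decide
  let z : C := ⟨ρ (.a 2), Subgroup.mem_centralizer_iff.2 <| Set.forall_mem_range.2 fun r => by
    rw [← map_mul, (hcenter _).2 (.inr rfl), map_mul]⟩
  have hz : z ≠ 1 := fun h =>
    absurd (hρ ((congrArg Subtype.val h).trans (map_one ρ).symm)) (by decide)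
  have hzz : ρ (.a 2) * ρ (.a 2) = 1 := congrArg Subtype.val ((sq z).symm.trans (hC2 z))
  obtain ⟨E, hzE, hE⟩ := exists_subgroup_notMem_and_forall_mem_or_mul_mem hC2 hz
  let Φ : QuaternionGroup 2 × E →* G :=
    MonoidHom.noncommCoprod ρ (C.subtype.comp E.subtype) fun q e => hcomm q e
  refine ⟨E, inferInstance, fun e => Subtype.ext (hC2 e), ⟨(MulEquiv.ofBijective Φ ⟨?_, ?_⟩).symm⟩⟩
  · refine (injective_iff_map_eq_one _).2 fun ⟨q, e⟩ h => ?_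
    have hq : ρ q = (e⁻¹ : E).1.1 := mul_eq_one_iff_eq_inv.1 h
    have hqcomm : ∀ r, r * q = q * r := fun r => hρ (by
      rw [map_mul, map_mul, hq, (hcomm r _).eq])
    rcases (hcenter q).1 hqcomm with rfl | rfl
    · have he : e⁻¹ = 1 := Subtype.ext (Subtype.ext (hq.symm.trans (map_one ρ)))
      rw [inv_eq_one.1 he]
      rfl
    · exact absurd ((Subtype.ext hq : z = (e⁻¹ : E).1) ▸ (e⁻¹ : E).2) hzE
  · intro g
    obtain ⟨c, hc, q, rfl⟩ := hG g
    rcases hE ⟨c, hc⟩ with he | he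
    · exact ⟨(q, ⟨_, he⟩), hcomm q ⟨c, hc⟩⟩
    · refine ⟨(.a 2 * q, ⟨_, he⟩), (hcomm _ (z * ⟨c, hc⟩)).trans ?_⟩
      calc ρ (.a 2) * c * ρ (.a 2 * q) = c * (ρ (.a 2) * ρ (.a 2)) * ρ q := by
            rw [map_mul, (hcomm (.a 2) ⟨c, hc⟩).eq]
            simp only [mul_assoc]
        _ = c * ρ q := by rw [hzz, mul_one]

theorem CommutesOrInverts.exists_mulEquiv_quaternionGroup_prod {G : Type u} [Group G]
    (h : CommutesOrInverts G) {x y : G} (hxy : ¬ Commute x y) :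
    ∃ (E : Type u) (_ : CommGroup E), (∀ e : E, e ^ 2 = 1) ∧
      Nonempty (G ≃* QuaternionGroup 2 × E) := by
  refine exists_mulEquiv_quaternionGroup_prod_of_injective (h.quaternionHom_injective hxy)
    (fun c hc => ?_) (h.exists_eq_mul_quaternionHom hxy)
  obtain ⟨hcx, hcy⟩ := (h.mem_centralizer_range_quaternionHom_iff hxy).1 hc
  rw [sq, h.mul_self_eq_one_of_commute hxy hcx hcy]

end StructureTheorem

theorem exponent_dvd_four_or_six_of_unitFiltration_eq_bot {G : Type*} [CommGroup G] {n : ℕ}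
    (h : unitFiltration G n = ⊥) (hG : IsMulTorsion G) :
    Monoid.exponent G ∣ 4 ∨ Monoid.exponent G ∣ 6 := by
  have hord := fun g : G => orderOf_dvd_four_or_six_of_unitFiltration_eq_bot h (hG g)
  have hexp : Monoid.ExponentExists G := ⟨12, by norm_num, fun g => orderOf_dvd_iff_pow_eq_one.1 <|
    (hord g).elim (·.trans (by norm_num)) (·.trans (by norm_num))⟩
  obtain ⟨g, hg⟩ := Monoid.exists_orderOf_eq_exponent hexp
  exact hg ▸ hord g

theorem isCutGroup_iff_exponent_dvd {G : Type*} [CommGroup G] (hG : IsMulTorsion G) :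
    IsCutGroup G ↔ Monoid.exponent G ∣ 4 ∨ Monoid.exponent G ∣ 6 := by
  rw [isCutGroup_iff_hasTrivialUnits mul_comm]
  refine ⟨fun h => ?_, hasTrivialUnits_of_exponent_dvd⟩
  exact exponent_dvd_four_or_six_of_unitFiltration_eq_bot (unitFiltration_two_eq_bot h) hG

theorem exists_unitFiltration_eq_bot_iff_isCutGroup {G : Type*} [CommGroup G]
    (hG : IsMulTorsion G) : (∃ n, 1 ≤ n ∧ unitFiltration G n = ⊥) ↔ IsCutGroup G := by
  constructor
  · rintro ⟨n, -, h⟩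
    rw [isCutGroup_iff_exponent_dvd hG]
    exact exponent_dvd_four_or_six_of_unitFiltration_eq_bot h hG
  · intro h
    exact ⟨2, one_le_two, unitFiltration_two_eq_bot ((isCutGroup_iff_hasTrivialUnits mul_comm).1 h)⟩

theorem mainTheorem1_general (G : Type u) [Group G] (hG : IsMulTorsion G) :
    ((∃ n : ℕ, 1 ≤ n ∧ unitFiltration G n = ⊥) ↔
      (((∀ a b : G, a * b = b * a) ∧ IsCutGroup G) ∨
        ∃ (E : Type u) (_ : CommGroup E), (∀ e : E, e ^ 2 = 1) ∧
          Nonempty (G ≃* QuaternionGroup 2 × E))) ∧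
    ((∀ a b : G, a * b = b * a) →
      (IsCutGroup G ↔ (Monoid.exponent G ∣ 4 ∨ Monoid.exponent G ∣ 6))) := by
  have habelian (hcomm : ∀ a b : G, a * b = b * a) :
      ((∃ n : ℕ, 1 ≤ n ∧ unitFiltration G n = ⊥) ↔ IsCutGroup G) ∧
        (IsCutGroup G ↔ Monoid.exponent G ∣ 4 ∨ Monoid.exponent G ∣ 6) := by
    let : CommGroup G := { ‹Group G› with mul_comm := hcomm }
    exact ⟨exists_unitFiltration_eq_bot_iff_isCutGroup hG, isCutGroup_iff_exponent_dvd hG⟩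
  refine ⟨⟨fun hV => ?_, ?_⟩, fun hcomm => (habelian hcomm).2⟩
  · by_cases hcomm : ∀ a b : G, a * b = b * a
    · exact .inl ⟨hcomm, (habelian hcomm).1.1 hV⟩
    · obtain ⟨n, -, h⟩ := hV
      push Not at hcomm
      obtain ⟨x, y, hxy⟩ := hcomm
      have hinverts := commutesOrInverts_of_unitFiltration_eq_bot h hG
      exact .inr (hinverts.exists_mulEquiv_quaternionGroup_prod hxy)
  · rintro (⟨hcomm, hcut⟩ | ⟨E, _, hE, ⟨e⟩⟩)
    · exact (habelian hcomm).1.2 hcut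
    · exact ⟨3, by norm_num, unitFiltration_eq_bot_of_injective (f := e.toMonoidHom) e.injective
        (unitFiltration_quaternionGroup_prod_three_eq_bot hE)⟩

theorem mainTheorem1 (G : Type u) [Group G] [Finite G] :
    ((∃ n : ℕ, 1 ≤ n ∧ unitFiltration G n = ⊥) ↔
      (((∀ a b : G, a * b = b * a) ∧ IsCutGroup G) ∨
        ∃ (E : Type u) (_ : CommGroup E), (∀ e : E, e ^ 2 = 1) ∧
          Nonempty (G ≃* QuaternionGroup 2 × E))) ∧
    ((∀ a b : G, a * b = b * a) →
      (IsCutGroup G ↔ (Monoid.exponent G ∣ 4 ∨ Monoid.exponent G ∣ 6))) :=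
  mainTheorem1_general G isMulTorsion_of_finite
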